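/- Let $\ell\ge 1$ and let $S=\mathbb{R}[x_1,\dots,x_\ell,z]$. Let $\Phi_+^C=\{2x_i \mid 1\le i\le \ell\}\cup\{x_p+x_q,\ x_p-x_q \mid 1\le p<q\le \ell\}$ be the positive roots of type $C_\ell$, and let $\mathcal{S}(C_\ell)$ be the cone over the Shi arrangement of type $C_\ell$, that is, the central arrangement in $\mathbb{R}^{\ell+1}$ defined by $z\prod_{\alpha\in\Phi_+^C}\alpha(\alpha-z)=0$. Let $$D(\mathcal{S}(C_\ell))=\{\theta\in\mathrm{Der}_{\mathbb{R}}(S)\mid z \text{ divides } \theta(z),\ \alpha \text{ divides } \theta(\alpha) \text{ and } \alpha-z \text{ divides } \theta(\alpha-z) \text{ for all } \alpha\in\Phi_+^C\}.$$ For integers $r\ge 1$, $s\ge 0$ let $B^C_{r,s}(x)\in\mathbb{R}[x]$ be the unique polynomial with $$B^C_{r,s}(x+1)-B^C_{r,s}(x)=\{(x+1)^{r-1}+(-x)^{r-1}\}(x+1)^s(-x)^s,\qquad B^C_{r,s}(0)=0,$$ which has degree at most $r+2s$, and let $\overline{B}^C_{r,s}(x,z)=z^{r+2s}B^C_{r,s}(x/z)\in\mathbb{R}[x,z]$.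 Write $\sigma_k$ for the elementary symmetric polynomial of degree $k$, $\partial_i=\partial/\partial x_i$ and $\partial_z=\partial/\partial z$. For $1\le j\le\ell$ put $$\varphi_j^C=(-1)^j\sum_{i=1}^{\ell}\Biggl\{\sum_{\substack{N_1,N_2\subset\{1,\dots,j-1\}\\ N_1\cap N_2=\emptyset}}\Bigl(\prod_{t\in N_1}x_t^2\Bigr)\Bigl(\prod_{t\in N_2}(-x_tz)\Bigr)\sum_{\substack{0\le k_2\le 1\\ 0\le k_3\le \ell-j}}(-1)^{k_2+k_3}\,\sigma_{k_2}(x_j)\,\sigma_{k_3}(x_{j+1}^2,\dots,x_\ell^2)\,\overline{B}^C_{r,s}(x_i,z)\Biggr\}\partial_i,$$ where $r=2\ell-2j-k_2-2k_3+2$ and $s=(j-1)-|N_1|-|N_2|$, and let $\theta_E=z\,\partial_z+\sum_{i=1}^{\ell}x_i\,\partial_i$ be the Euler derivation. Then $\theta_E,\varphi_1^C,\dots,\varphi_\ell^C$ form a basis of the $S$-module $D(\mathcal{S}(C_\ell))$. -/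

import Mathlib

open scoped BigOperators

namespace ShiC

noncomputable section

section BernoulliLike

open Polynomial

/-- Every real polynomial `P` of degree at most `n` has an antidifference of degree at most `n + 1`
that vanishes at `0`. -/
theorem exists_antidifference (n : ℕ) (P : ℝ[X]) (hP : P.natDegree ≤ n) :
    ∃ Q : ℝ[X], Q.natDegree ≤ n + 1 ∧ Q.comp (X + 1) - Q = P ∧ Q.eval 0 = 0 := by
  refine Polynomial.induction_with_natDegree_le
    (fun P : ℝ[X] => ∃ Q : ℝ[X], Q.natDegree ≤ n + 1 ∧ Q.comp (X + 1) - Q = P ∧ Q.eval 0 = 0)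
    n ⟨0, by simp⟩ ?_ ?_ P hP
  · intro m a _ hm
    let R : ℝ[X] := (Polynomial.bernoulli (m + 1)).map (algebraMap ℚ ℝ)
    have hR : R.natDegree ≤ m + 1 := by
      refine natDegree_map_le.trans ?_
      rw [Polynomial.bernoulli]
      refine natDegree_sum_le_of_forall_le _ _ fun i hi => ?_
      refine (natDegree_monomial_le _).trans ?_
      omega
    have hRd : R.comp (X + 1) - R = C ((m : ℝ) + 1) * X ^ m := by
      have h := congrArg (Polynomial.map (algebraMap ℚ ℝ))
        (Polynomial.bernoulli_comp_one_add_X (m + 1))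
      simp only [Polynomial.map_comp, Polynomial.map_add, Polynomial.map_one, Polynomial.map_X]
        at h
      change R.comp (1 + X) = _ at h
      rw [add_comm X 1, h]
      simp [R]
    have hm0 : ((m : ℝ) + 1) ≠ 0 := by positivity
    refine ⟨C (a / (m + 1)) * (R - C (R.eval 0)), ?_, ?_, by simp⟩
    · refine (natDegree_C_mul_le _ _).trans ((natDegree_sub_le _ _).trans ?_)
      simp only [natDegree_C, max_le_iff]
      omega
    · have : (C (a / (m + 1)) * (R - C (R.eval 0))).comp (X + 1)
          - C (a / (m + 1)) * (R - C (R.eval 0)) = C (a / (m + 1)) * (R.comp (X + 1) - R) := by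
        simp only [mul_comp, sub_comp, C_comp]
        ring
      rw [this, hRd, ← mul_assoc, ← C_mul, div_mul_cancel₀ _ hm0]
  · rintro f g _ _ ⟨Q₁, h₁, h₁', h₁''⟩ ⟨Q₂, h₂, h₂', h₂''⟩
    refine ⟨Q₁ + Q₂, (natDegree_add_le _ _).trans (max_le h₁ h₂), ?_, by simp [h₁'', h₂'']⟩
    rw [← h₁', ← h₂', add_comp]
    ring

/-- An antidifference vanishing at `0` is unique. -/
theorem antidifference_unique {P Q₁ Q₂ : ℝ[X]}
    (h₁ : Q₁.comp (X + 1) - Q₁ = P ∧ Q₁.eval 0 = 0)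
    (h₂ : Q₂.comp (X + 1) - Q₂ = P ∧ Q₂.eval 0 = 0) : Q₁ = Q₂ := by
  rw [← sub_eq_zero]
  have hcomp : (Q₁ - Q₂).comp (X + 1) = Q₁ - Q₂ := by
    rw [sub_comp]
    linear_combination h₁.1 - h₂.1
  have hz : ∀ k : ℕ, (Q₁ - Q₂).eval (k : ℝ) = 0 := by
    intro k
    induction k with
    | zero => simp [h₁.2, h₂.2]
    | succ k ih =>
      rw [← ih]
      conv_rhs => rw [← hcomp]
      simp
  refine eq_zero_of_infinite_isRoot _ ?_
  exact (Set.infinite_range_of_injective (Nat.cast_injective (R := ℝ))).mono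
    (by rintro _ ⟨k, rfl⟩; exact hz k)

/-- The right-hand side `{(x+1)^{r-1} + (-x)^{r-1}} (x+1)^s (-x)^s`, for `r ≥ 1`. -/
def rhsC (r s : ℕ) : ℝ[X] :=
  ((X + 1) ^ (r - 1) + (-X) ^ (r - 1)) * (X + 1) ^ s * (-X) ^ s

/-- There is exactly one polynomial `B` with `B(x+1) - B(x) = rhsC r s` and `B(0) = 0`. -/
theorem existsUnique_BC (r s : ℕ) :
    ∃! B : ℝ[X], B.comp (X + 1) - B = rhsC r s ∧ B.eval 0 = 0 := by
  obtain ⟨Q, -, h⟩ := exists_antidifference _ (rhsC r s) le_rfl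
  exact ⟨Q, h, fun Q' h' => antidifference_unique h' h⟩

/-- The polynomial `B^C_{r,s}(x)`, for `r ≥ 1` and `s ≥ 0` (only such `r` are used): the unique
polynomial with `B(x+1) - B(x) = {(x+1)^{r-1} + (-x)^{r-1}} (x+1)^s (-x)^s` and `B(0) = 0`. -/
def BC (r s : ℕ) : ℝ[X] := (existsUnique_BC r s).choose

theorem BC_spec (r s : ℕ) :
    (BC r s).comp (X + 1) - BC r s = rhsC r s ∧ (BC r s).eval 0 = 0 :=
  (existsUnique_BC r s).choose_spec.1

theorem natDegree_BC_le {r : ℕ} (hr : 0 < r) (s : ℕ) : (BC r s).natDegree ≤ r + 2 * s := by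
  have hP : (rhsC r s).natDegree ≤ r - 1 + s + s := by
    unfold rhsC
    compute_degree
  obtain ⟨Q, hQ, h⟩ := exists_antidifference _ (rhsC r s) hP
  rw [antidifference_unique (BC_spec r s) h]
  omega

/-- The homogenization of `B^C_{r,s}` as a polynomial in two variables `(x, z) = (X 0, X 1)`. -/
def BCbar (r s : ℕ) : MvPolynomial (Fin 2) ℝ := (BC r s).homogenize (r + 2 * s)

/-- `BCbar r s (x, z) = z^{r+2s} B^C_{r,s}(x/z)`. -/
theorem eval_BCbar {r : ℕ} (hr : 0 < r) (s : ℕ) (x z : ℝ) (hz : z ≠ 0) :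
    MvPolynomial.eval ![x, z] (BCbar r s) = z ^ (r + 2 * s) * (BC r s).eval (x / z) := by
  rw [BCbar, Polynomial.eval_homogenize (natDegree_BC_le hr s) _ (by simpa using hz)]
  simp [mul_comm]

end BernoulliLike

open MvPolynomial

/-- The algebra `S` of polynomial functions on `V = ℝ^{ℓ+1}`: the coordinates are
`x_1, …, x_ℓ` (indices `some i`) and `z` (index `none`). -/
abbrev S (ℓ : ℕ) : Type := MvPolynomial (Option (Fin ℓ)) ℝ

/-- The coordinate `z`. -/
def z (ℓ : ℕ) : S ℓ := X none

/-- The coordinate `x_i`. -/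
def x {ℓ : ℕ} (i : Fin ℓ) : S ℓ := X (some i)

/-- The module `Der(S)` of `ℝ`-linear derivations of `S` to itself. -/
abbrev Der (ℓ : ℕ) : Type := Derivation ℝ (S ℓ) (S ℓ)

/-- The positive roots of type `C_ℓ`: `2 x_i`, and `x_p + x_q`, `x_p - x_q` for `p < q`. -/
def posRootsC (ℓ : ℕ) : Set (S ℓ) :=
  {α | (∃ i : Fin ℓ, α = 2 * x i) ∨
    ∃ p q : Fin ℓ, p < q ∧ (α = x p + x q ∨ α = x p - x q)}

/-- The derivation module of the cone over the Shi arrangement with positive roots `Φ`. -/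
def shiConeDer {ℓ : ℕ} (Φ : Set (S ℓ)) : Submodule (S ℓ) (Der ℓ) where
  carrier := {θ | z ℓ ∣ θ (z ℓ) ∧ ∀ α ∈ Φ, α ∣ θ α ∧ (α - z ℓ) ∣ θ (α - z ℓ)}
  zero_mem' := by simp
  add_mem' := by
    rintro θ η ⟨hθ, hθ'⟩ ⟨hη, hη'⟩
    simp only [Set.mem_ofPred_eq, Derivation.add_apply]
    exact ⟨dvd_add hθ hη, fun α hα =>
      ⟨dvd_add (hθ' α hα).1 (hη' α hα).1, dvd_add (hθ' α hα).2 (hη' α hα).2⟩⟩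
  smul_mem' := by
    rintro f θ ⟨hθ, hθ'⟩
    simp only [Set.mem_ofPred_eq, Derivation.smul_apply, smul_eq_mul]
    exact ⟨hθ.mul_left f, fun α hα => ⟨(hθ' α hα).1.mul_left f, (hθ' α hα).2.mul_left f⟩⟩

/-- The derivation module `D(S(C_ℓ))`. -/
def DSC (ℓ : ℕ) : Submodule (S ℓ) (Der ℓ) := shiConeDer (posRootsC ℓ)

/-- The Euler derivation `θ_E = z ∂_z + ∑ x_i ∂_i`. -/
def eulerDer (ℓ : ℕ) : Der ℓ :=
  z ℓ • pderiv none + ∑ i : Fin ℓ, x i • pderiv (some i)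

/-- `σ_k(x_j)`, the elementary symmetric polynomial of degree `k` in the single variable `x_j`. -/
def sigma2 {ℓ : ℕ} (j : Fin ℓ) (k : ℕ) : S ℓ := ({x j} : Multiset (S ℓ)).esymm k

/-- `σ_k(x_{j+1}², …, x_ℓ²)`, the elementary symmetric polynomial of degree `k` in the squares of
the variables after `x_j`. -/
def tau3 {ℓ : ℕ} (j : Fin ℓ) (k : ℕ) : S ℓ :=
  ((Finset.Ioi j).val.map fun t => x t ^ 2).esymm k

/-- The coefficient of `∂_i` in `φ_j^C`, without the sign `(-1)^j`. An index `j : Fin ℓ` stands for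
the index `j + 1` of the usual numbering `1, …, ℓ`, so that
`r = 2ℓ - 2(j+1) - k₂ - 2k₃ + 2 ≥ 1`, with `0 ≤ k₂ ≤ 1` and `0 ≤ k₃ ≤ ℓ - (j+1)`, and the pairs
`N₁, N₂` run over the disjoint subsets of the set of indices before `j`. -/
def phiCoeff {ℓ : ℕ} (j i : Fin ℓ) : S ℓ :=
  ∑ N₁ ∈ (Finset.Iio j).powerset, ∑ N₂ ∈ (Finset.Iio j).powerset with Disjoint N₁ N₂,
    (∏ t ∈ N₁, x t ^ 2) * (∏ t ∈ N₂, -(x t * z ℓ)) *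
      ∑ k₂ ∈ Finset.range 2, ∑ k₃ ∈ Finset.range (ℓ - (j + 1) + 1),
        (-1) ^ (k₂ + k₃) * sigma2 j k₂ * tau3 j k₃ *
          aeval ![x i, z ℓ]
            (BCbar (2 * ℓ + 2 - 2 * (j + 1) - k₂ - 2 * k₃) (Finset.Iio j \ (N₁ ∪ N₂)).card)

/-- The derivation `φ_j^C`; the index `j : Fin ℓ` stands for `j + 1` in the usual numbering. -/
def phiC {ℓ : ℕ} (j : Fin ℓ) : Der ℓ :=
  (-1 : S ℓ) ^ ((j : ℕ) + 1) • ∑ i : Fin ℓ, phiCoeff j i • pderiv (some i)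

end

end ShiC

/-! The coefficients of `phiC j` are, up to a common sign, the values F_j(x_i) of a single
polynomial F_j = `phiPoly j` in a new variable. It is odd, and summing the difference equations of
the B^C_{r,s} gives (`eval_phiPoly_add_sub`) F_j(a + z) - F_j(a) = z ∏_{t<j} (x_t + a)(x_t - a - z)
· (T_j(a + z) + T_j(-a)), where T_j(u) = (u - x_j) ∏_{t>j} (u² - x_t²).

Membership: x_p - x_q divides F_j(x_p) - F_j(x_q) for any polynomial, and oddness handles x_p + x_q.
Modulo x_p - a - z with a = ±x_q, the value F_j(x_p) becomes F_j(a + z), and the right-hand side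
above is divisible by x_p - a - z (`dvd_phiPoly_eval_sub`).

Basis: the arrangement has 2ℓ² + 1 hyperplanes, which is also the sum of the degree bounds 1, 2ℓ, …,
2ℓ. By Saito's criterion (`exists_basis_of_det_ne_zero`) a nonzero determinant suffices, and one
point where it does not vanish is enough (`det_ne_zero`). At x = (1, …, ℓ), z = 1, a linear relation
among the rows yields an odd polynomial of degree at most 2ℓ with the 2ℓ + 1 roots -ℓ, …, ℓ, hence
zero. Its differences at the points -x_j form a triangular system with nonzero diagonal, so the
relation is trivial. -/

namespace ShiC

open MvPolynomial

/-! ### Saito's criterion for linear forms -/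

section Saito

open Matrix

variable {σ ι K : Type*} [Field K] [Fintype σ]

/-- The linear form with the given coefficients. -/
noncomputable def linForm (c : σ → K) : MvPolynomial σ K := ∑ v, C (c v) * X v

theorem coeff_linForm (c : σ → K) (v : σ) :
    (linForm c).coeff (Finsupp.single v 1) = c v := by
  classical
  rw [linForm, coeff_sum, Finset.sum_eq_single v]
  · simp
  · intro w _ hw
    rw [coeff_C_mul, coeff_X, if_neg, mul_zero]
    simpa [Finsupp.single_left_inj] using hw
  · simp

theorem linForm_injective : Function.Injective (linForm : (σ → K) → MvPolynomial σ K) := by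
  intro a b h
  ext v
  rw [← coeff_linForm a, ← coeff_linForm b, h]

theorem isHomogeneous_linForm (c : σ → K) : (linForm c).IsHomogeneous 1 := by
  refine IsHomogeneous.sum _ _ _ fun v _ => ?_
  simpa using (isHomogeneous_C σ (c v)).mul (isHomogeneous_X K v)

theorem linForm_ne_zero {c : σ → K} (hc : c ≠ 0) : linForm c ≠ 0 := by
  rintro h
  exact hc (linForm_injective (h.trans (by simp [linForm])))

theorem totalDegree_linForm {c : σ → K} (hc : c ≠ 0) : (linForm c).totalDegree = 1 :=
  (isHomogeneous_linForm c).totalDegree (linForm_ne_zero hc)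

theorem irreducible_linForm {c : σ → K} (hc : c ≠ 0) : Irreducible (linForm c) := by
  refine irreducible_of_totalDegree_eq_one (totalDegree_linForm hc) fun k hk => ?_
  obtain ⟨v, hv⟩ := Function.ne_iff.1 hc
  have := hk (Finsupp.single v 1)
  rw [coeff_linForm] at this
  refine isUnit_iff_ne_zero.2 ?_
  rintro rfl
  exact hv (by simpa using this)

theorem isRelPrime_linForm {a b : σ → K} (ha : a ≠ 0) (hb : b ≠ 0) (hab : ∀ k : K, b ≠ k • a) :
    IsRelPrime (linForm a) (linForm b) := by
  rw [(irreducible_linForm ha).isRelPrime_iff_not_dvd]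
  rintro ⟨u, hu⟩
  have hb0 := linForm_ne_zero hb
  rw [hu] at hb0
  have hdeg := congrArg totalDegree hu
  rw [totalDegree_mul_of_isDomain (left_ne_zero_of_mul hb0) (right_ne_zero_of_mul hb0),
    totalDegree_linForm ha, totalDegree_linForm hb] at hdeg
  rw [totalDegree_eq_zero_iff_eq_C.1 (by omega : u.totalDegree = 0)] at hu
  refine hab (u.coeff 0) (linForm_injective ?_)
  rw [hu, mul_comm]
  simp [linForm, Finset.mul_sum, mul_assoc]

variable [DecidableEq σ]

/-- A linear form that divides the value of all the derivations on it divides the determinant of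
the coefficient matrix. -/
theorem linForm_dvd_det {c : σ → K} (hc : c ≠ 0)
    (θ : σ → Derivation K (MvPolynomial σ K) (MvPolynomial σ K))
    (hθ : ∀ i, linForm c ∣ θ i (linForm c)) :
    linForm c ∣ (Matrix.of fun i v => θ i (X v)).det := by
  set M := Matrix.of fun i v => θ i (X v) with hM
  choose g hg using hθ
  have hMc : M *ᵥ (fun v => C (c v)) = linForm c • g := by
    ext1 i
    rw [Pi.smul_apply, smul_eq_mul, ← hg, linForm]
    simp [mulVec, dotProduct, hM, mul_comm, ← MvPolynomial.algebraMap_eq]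
  obtain ⟨v, hv⟩ := Function.ne_iff.1 hc
  -- Multiplying `M c = linForm c • g` by the adjugate gives `det M • c = linForm c • (adj M) g`; a
  -- coordinate with `c v ≠ 0` is a unit.
  have h := congrArg (fun w => (M.adjugate *ᵥ w) v) hMc
  simp only [mulVec_mulVec, adjugate_mul, smul_mulVec, one_mulVec, mulVec_smul, Pi.smul_apply,
    smul_eq_mul] at h
  have hunit : IsUnit (C (c v) : MvPolynomial σ K) := (isUnit_iff_ne_zero.2 hv).map C
  exact hunit.dvd_mul_right.1 ⟨_, h⟩

theorem totalDegree_det_le (M : Matrix σ σ (MvPolynomial σ K)) (d : σ → ℕ)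
    (hM : ∀ i v, (M i v).totalDegree ≤ d i) : M.det.totalDegree ≤ ∑ i, d i := by
  -- After transposition each term of the expansion takes one entry from row `i` for every `i`, so
  -- the row bounds add up without reindexing.
  rw [← det_transpose, det_apply]
  refine totalDegree_finsetSum_le fun τ _ => ?_
  refine (totalDegree_smul_le _ _).trans ((totalDegree_finsetProd _ _).trans ?_)
  exact Finset.sum_le_sum fun i _ => hM _ _

theorem derivation_sum_apply {κ R A : Type*} [CommRing R] [CommRing A] [Algebra R A]
    (s : Finset κ) (θ : κ → Derivation R A A) (f : A) : (∑ i ∈ s, θ i) f = ∑ i ∈ s, θ i f := by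
  classical
  induction s using Finset.induction_on with
  | empty => simp
  | insert i s hi ih => simp [Finset.sum_insert hi, ih]

/-- **Saito's criterion** for a family of derivations that are logarithmic along pairwise
non-proportional linear forms, with a bound on the degrees in place of the value of the
determinant. -/
theorem exists_basis_of_det_ne_zero [Fintype ι] (a : ι → σ → K) (ha : ∀ i, a i ≠ 0)
    (hpair : ∀ i j, i ≠ j → ∀ k : K, a j ≠ k • a i)
    (D : Submodule (MvPolynomial σ K) (Derivation K (MvPolynomial σ K) (MvPolynomial σ K)))
    (hD : ∀ θ ∈ D, ∀ i, linForm (a i) ∣ θ (linForm (a i)))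
    (θ : σ → D) (d : σ → ℕ)
    (hd : ∀ i v, ((θ i : Derivation K (MvPolynomial σ K) (MvPolynomial σ K)) (X v)).totalDegree
      ≤ d i)
    (hdsum : ∑ i, d i ≤ Fintype.card ι)
    (hdet : (Matrix.of fun i v =>
      (θ i : Derivation K (MvPolynomial σ K) (MvPolynomial σ K)) (X v)).det ≠ 0) :
    ∃ b : Module.Basis σ (MvPolynomial σ K) D, ∀ i, b i = θ i := by
  set M := Matrix.of fun i v =>
    (θ i : Derivation K (MvPolynomial σ K) (MvPolynomial σ K)) (X v) with hM
  have hQ : ∀ η : σ → D, (∏ i, linForm (a i)) ∣ (Matrix.of fun i v =>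
      (η i : Derivation K (MvPolynomial σ K) (MvPolynomial σ K)) (X v)).det := fun η =>
    Fintype.prod_dvd_of_isRelPrime
      (fun i j hij => isRelPrime_linForm (ha i) (ha j) (hpair i j hij))
      fun i => linForm_dvd_det (ha i) (fun j => (η j : Derivation K _ _))
        fun j => hD _ (η j).2 i
  have hQ0 : ∏ i, linForm (a i) ≠ 0 := Finset.prod_ne_zero_iff.2 fun i _ => linForm_ne_zero (ha i)
  have hQdeg : (∏ i, linForm (a i)).totalDegree = Fintype.card ι := by
    have h : (∏ i, linForm (a i)).IsHomogeneous (∑ _i : ι, 1) :=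
      IsHomogeneous.prod _ _ _ fun i _ => isHomogeneous_linForm (a i)
    rw [h.totalDegree hQ0]
    simp
  -- The product of the forms divides `det M`, whose degree is at most the number of forms, so the
  -- quotient is a nonzero constant.
  have hMQ : M.det ∣ ∏ i, linForm (a i) := by
    obtain ⟨h, hh⟩ := hQ θ
    rw [← hM] at hh
    have h0 : h ≠ 0 := by
      rintro rfl
      exact hdet (by rw [hh, mul_zero])
    have hdeg := congrArg totalDegree hh
    rw [totalDegree_mul_of_isDomain hQ0 h0, hQdeg] at hdeg
    have hle := totalDegree_det_le M d hd
    have hC := totalDegree_eq_zero_iff_eq_C.1 (by omega : h.totalDegree = 0)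
    have hu : IsUnit h := by
      rw [hC]
      refine (isUnit_iff_ne_zero.2 ?_).map C
      intro hz
      rw [hz, map_zero] at hC
      exact h0 hC
    rw [hh]
    exact hu.mul_right_dvd.2 dvd_rfl
  have happ : ∀ (g : σ → MvPolynomial σ K) (v : σ),
      ((∑ i, g i • θ i : D) : Derivation K (MvPolynomial σ K) (MvPolynomial σ K)) (X v)
        = (g ᵥ* M) v := by
    intro g v
    simp [vecMul, dotProduct, hM, derivation_sum_apply]
  refine ⟨Module.Basis.mk (v := θ) ?_ ?_, fun i => Module.Basis.mk_apply _ _ i⟩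
  · refine Fintype.linearIndependent_iffₛ.2 fun f g hfg => ?_
    have : (f - g) ᵥ* M = 0 := by
      ext1 v
      rw [sub_vecMul, Pi.sub_apply, ← happ, ← happ, hfg, sub_self, Pi.zero_apply]
    exact fun i => sub_eq_zero.1 (congrFun (eq_zero_of_vecMul_eq_zero hdet this) i)
  · rintro η -
    let t : σ → MvPolynomial σ K :=
      fun v => (η : Derivation K (MvPolynomial σ K) (MvPolynomial σ K)) (X v)
    -- Cramer's rule: the numerators are determinants of families in `D`, with `η` in place of `θ
    -- i`. They are divisible by the product of the forms, hence by `det M`, so the coefficients of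
    -- `η` are polynomials.
    have hcr : ∀ i, M.det ∣ cramer Mᵀ t i := by
      intro i
      refine hMQ.trans ?_
      rw [cramer_transpose_apply]
      convert hQ (Function.update θ i η) using 2
      ext1 j v
      by_cases hj : j = i
      · subst hj
        simp [t]
      · simp [hj, hM]
    choose g hg using hcr
    have key : g ᵥ* M = t := by
      have h := mulVec_cramer Mᵀ t
      rw [det_transpose, show cramer Mᵀ t = M.det • g from funext hg, mulVec_smul,
        mulVec_transpose] at h
      exact smul_right_injective _ hdet h
    rw [Submodule.mem_span_range_iff_exists_fun]
    refine ⟨g, Subtype.ext (MvPolynomial.derivation_ext fun v => ?_)⟩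
    rw [happ, key]

end Saito

/-! ### The linear forms of the Shi cone -/

/-- The coefficient vector of a positive root: `x_p + x_q` for `p ≤ q` and `x_q - x_p` for
`q < p`. -/
def rootVec {ℓ : ℕ} (p q : Fin ℓ) (v : Fin ℓ) : ℝ :=
  (if v = q then 1 else 0) + if p ≤ q then (if v = p then 1 else 0) else (if v = p then -1 else 0)

/-- The order of `p` and `q` encodes the sign, so the ℓ² ordered pairs index the positive roots
without repetition. No two of these are proportional; both supports lie in `{p, q, p', q'}`, so four
coordinates decide. -/
theorem rootVec_smul_eq {ℓ : ℕ} {p q p' q' : Fin ℓ} {k : ℝ}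
    (h : ∀ v, rootVec p q v = k * rootVec p' q' v) : p = p' ∧ q = q' ∧ k = 1 := by
  have h1 := h p
  have h2 := h q
  have h3 := h p'
  have h4 := h q'
  unfold rootVec at h1 h2 h3 h4
  grind

theorem rootVec_self_pos {ℓ : ℕ} (p q : Fin ℓ) : 0 < rootVec p q q := by
  unfold rootVec
  split_ifs <;> simp_all

/-- The coefficient vectors of the linear forms defining the cone over the Shi arrangement. -/
def shiVec {ℓ : ℕ} : Option ((Fin ℓ × Fin ℓ) × Bool) → Option (Fin ℓ) → ℝ
  | none => fun v => v.elim 1 fun _ => 0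
  | some (a, b) => fun v => v.elim (if b then -1 else 0) (rootVec a.1 a.2)

theorem shiVec_ne_zero {ℓ : ℕ} (i : Option ((Fin ℓ × Fin ℓ) × Bool)) : shiVec i ≠ 0 := by
  rcases i with _ | ⟨⟨p, q⟩, b⟩ <;> intro h
  · simpa [shiVec] using congrFun h none
  · exact (rootVec_self_pos p q).ne' (congrFun h (some q))

theorem shiVec_ne_smul {ℓ : ℕ} (i j : Option ((Fin ℓ × Fin ℓ) × Bool)) (hij : i ≠ j) (k : ℝ) :
    shiVec j ≠ k • shiVec i := by
  intro h
  rcases i with _ | ⟨⟨p, q⟩, b⟩ <;> rcases j with _ | ⟨⟨p', q'⟩, b'⟩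
  · exact hij rfl
  · have := congrFun h (some q')
    simp [shiVec] at this
    exact (rootVec_self_pos p' q').ne' this
  · have h1 := congrFun h (some q)
    have h2 := congrFun h none
    simp only [shiVec, Option.elim, Pi.smul_apply, smul_eq_mul, zero_eq_mul,
      (rootVec_self_pos p q).ne', or_false] at h1 h2
    simp [h1] at h2
  -- The x-parts force the same root and factor 1; the z-coefficient, 0 or -1, then separates the
  -- two parallel hyperplanes.
  · obtain ⟨rfl, rfl, rfl⟩ := rootVec_smul_eq (fun v => congrFun h (some v))
    have h2 := congrFun h none
    cases b <;> cases b' <;> simp_all [shiVec]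

theorem linForm_rootVec {ℓ : ℕ} (p q : Fin ℓ) (c : ℝ) :
    linForm (fun v : Option (Fin ℓ) => v.elim c (rootVec p q)) =
      (if p ≤ q then x p + x q else x q - x p) + C c * z ℓ := by
  rw [linForm, Fintype.sum_option]
  simp only [Option.elim, rootVec, x, z]
  split_ifs <;>
    simp [add_mul, Finset.sum_add_distrib, apply_ite C, ite_mul] <;> ring

theorem mem_posRootsC {ℓ : ℕ} (p q : Fin ℓ) :
    (if p ≤ q then x p + x q else x q - x p) ∈ posRootsC ℓ := by
  split_ifs with h
  · rcases h.eq_or_lt with rfl | h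
    · exact Or.inl ⟨p, by ring⟩
    · exact Or.inr ⟨p, q, h, Or.inl rfl⟩
  · exact Or.inr ⟨q, p, not_le.1 h, Or.inr rfl⟩

theorem linForm_shiVec_dvd {ℓ : ℕ} (θ : Der ℓ) (hθ : θ ∈ DSC ℓ)
    (i : Option ((Fin ℓ × Fin ℓ) × Bool)) :
    linForm (shiVec i) ∣ θ (linForm (shiVec i)) := by
  obtain ⟨hz, h⟩ := hθ
  rcases i with _ | ⟨⟨p, q⟩, b⟩
  · have : linForm (shiVec (none : Option ((Fin ℓ × Fin ℓ) × Bool))) = z ℓ := by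
      simp [linForm, shiVec, z, Fintype.sum_option]
    rwa [this]
  · have h' := h _ (mem_posRootsC p q)
    rw [shiVec, linForm_rootVec]
    cases b
    · simpa using h'.1
    · simpa [sub_eq_add_neg] using h'.2

/-! ### Oddness and the homogenized difference equation of B^C -/

/-- Two polynomials in two variables that agree where the second variable does not vanish are
equal. -/
theorem eq_of_eval_eq_of_ne_zero {p q : MvPolynomial (Fin 2) ℝ}
    (h : ∀ a b : ℝ, b ≠ 0 → eval ![a, b] p = eval ![a, b] q) : p = q := by
  -- Multiplied by the second variable, both sides agree at every point, including those where it
  -- vanishes.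
  refine mul_left_cancel₀ (X_ne_zero (R := ℝ) (1 : Fin 2)) (MvPolynomial.funext fun v => ?_)
  have hv : v = ![v 0, v 1] := by
    ext i
    fin_cases i <;> rfl
  rw [map_mul, map_mul, eval_X]
  by_cases h1 : v 1 = 0
  · rw [h1, zero_mul, zero_mul]
  · rw [hv, h _ _ h1]

theorem eval_comp_add_one (r s : ℕ) (a : ℝ) :
    (BC r s).eval (a + 1) - (BC r s).eval a
      = ((a + 1) ^ (r - 1) + (-a) ^ (r - 1)) * (a + 1) ^ s * (-a) ^ s := by
  have h := congrArg (Polynomial.eval a) (BC_spec r s).1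
  simpa [rhsC] using h

/-- `B^C_{r,s}` is an odd polynomial. -/
theorem eval_BC_neg (r s : ℕ) (a : ℝ) : (BC r s).eval (-a) = -(BC r s).eval a := by
  -- The right-hand side of the difference equation is invariant under x ↦ -1 - x, which exchanges x
  -- + 1 and -x. Hence -B(-x) solves the same equation, and uniqueness applies.
  have h : -(BC r s).comp (-Polynomial.X) = BC r s := by
    refine antidifference_unique ⟨Polynomial.funext fun b => ?_, ?_⟩ (BC_spec r s)
    · have h1 := eval_comp_add_one r s (-(b + 1))
      rw [show -(b + 1) + 1 = -b by ring] at h1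
      simp only [Polynomial.eval_sub, Polynomial.eval_comp, Polynomial.eval_neg,
        Polynomial.eval_add, Polynomial.eval_X, Polynomial.eval_one, rhsC, Polynomial.eval_mul,
        Polynomial.eval_pow]
      linear_combination h1
    · simp [(BC_spec r s).2]
  have := congrArg (Polynomial.eval a) h
  simp only [Polynomial.eval_neg, Polynomial.eval_comp, Polynomial.eval_X] at this
  linarith

theorem map_aeval_pair {A B : Type*} [CommRing A] [CommRing B] [Algebra ℝ A] [Algebra ℝ B]
    (f : A →ₐ[ℝ] B) (a b : A) (p : MvPolynomial (Fin 2) ℝ) :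
    f (aeval ![a, b] p) = aeval ![f a, f b] p := by
  rw [← AlgHom.comp_apply, comp_aeval]
  congr 2
  ext i
  fin_cases i <;> rfl

section Homogenized

variable {A : Type*} [CommRing A] [Algebra ℝ A]

theorem aeval_aeval_pair (p u v : MvPolynomial (Fin 2) ℝ) (a b : A) :
    aeval ![a, b] (aeval ![u, v] p) = aeval ![aeval ![a, b] u, aeval ![a, b] v] p := by
  exact map_aeval_pair (aeval ![a, b]) u v p

theorem eval_aeval_pair (p u v : MvPolynomial (Fin 2) ℝ) (a b : ℝ) :
    eval ![a, b] (aeval ![u, v] p) = eval ![eval ![a, b] u, eval ![a, b] v] p := by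
  simpa only [MvPolynomial.aeval_eq_eval, RingHom.coe_coe] using aeval_aeval_pair p u v a b

/-- A polynomial identity over ℝ in two variables: it is checked at real points with `b ≠ 0`, where
dehomogenizing is possible, and then specialized to any algebra. -/
theorem aeval_BCbar_add_sub {r : ℕ} (hr : 0 < r) (s : ℕ) (a b : A) :
    aeval ![a + b, b] (BCbar r s) - aeval ![a, b] (BCbar r s)
      = b * (((a + b) ^ (r - 1) + (-a) ^ (r - 1)) * ((a + b) * -a) ^ s) := by
  have key : aeval ![(X 0 + X 1 : MvPolynomial (Fin 2) ℝ), X 1] (BCbar r s) - BCbar r s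
      = X 1 * (((X 0 + X 1) ^ (r - 1) + (-X 0) ^ (r - 1)) * ((X 0 + X 1) * -X 0) ^ s) := by
    refine eq_of_eval_eq_of_ne_zero fun a b hb => ?_
    rw [map_sub, eval_aeval_pair]
    simp only [map_mul, map_add, map_pow, map_neg, eval_X, Matrix.cons_val_zero,
      Matrix.cons_val_one]
    rw [eval_BCbar hr _ _ _ hb, eval_BCbar hr _ _ _ hb, ← mul_sub, add_div, div_self hb,
      eval_comp_add_one, show a / b + 1 = (a + b) / b by field_simp,
      show b ^ (r + 2 * s) = b * b ^ (r - 1) * b ^ s * b ^ s by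
        rw [mul_assoc, mul_assoc, ← pow_add, ← pow_add, ← pow_succ']
        congr 1
        omega,
      ← neg_div, div_pow, div_pow, div_pow, div_pow]
    field_simp
    rw [mul_assoc, ← mul_pow]
    ring
  have h := congrArg (aeval ![a, b]) key
  rw [map_sub, aeval_aeval_pair] at h
  simpa using h

theorem aeval_BCbar_neg {r : ℕ} (hr : 0 < r) (s : ℕ) (a b : A) :
    aeval ![-a, b] (BCbar r s) = -aeval ![a, b] (BCbar r s) := by
  have key : aeval ![(-X 0 : MvPolynomial (Fin 2) ℝ), X 1] (BCbar r s) = -BCbar r s := by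
    refine eq_of_eval_eq_of_ne_zero fun a b hb => ?_
    rw [map_neg, eval_aeval_pair]
    simp only [map_neg, eval_X, Matrix.cons_val_zero, Matrix.cons_val_one]
    rw [eval_BCbar hr _ _ _ hb, eval_BCbar hr _ _ _ hb, neg_div, eval_BC_neg]
    ring
  have h := congrArg (aeval ![a, b]) key
  rw [aeval_aeval_pair] at h
  simpa using h

end Homogenized

/-! ### The polynomial F_j and its difference equation -/

/-- Expansion of the product: `N₁` and `N₂` collect the factors contributing `f` and `g`, the others
contribute `c`. With `f t = x_t²`, `g t = -x_t z`, `c = -a(a + z)`, each factor is (x_t + a)(x_t - a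
- z). -/
theorem sum_disjoint_powerset_prod {α R : Type*} [DecidableEq α] [CommRing R] (J : Finset α)
    (f g : α → R) (c : R) :
    ∑ N₁ ∈ J.powerset, ∑ N₂ ∈ J.powerset with Disjoint N₁ N₂,
      (∏ t ∈ N₁, f t) * (∏ t ∈ N₂, g t) * c ^ (J \ (N₁ ∪ N₂)).card
        = ∏ t ∈ J, (f t + g t + c) := by
  simp only [add_assoc]
  rw [Finset.prod_add]
  refine Finset.sum_congr rfl fun N₁ _ => ?_
  rw [Finset.prod_add, Finset.mul_sum]
  refine Finset.sum_congr ?_ fun N₂ _ => ?_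
  · ext N
    simp only [Finset.mem_filter, Finset.mem_powerset, Finset.subset_sdiff, disjoint_comm]
  · rw [Finset.prod_const, sdiff_sdiff_left, mul_assoc]
    rfl

/-- The product `(u - x_j) ∏_{t > j} (u² - x_t²)`. -/
noncomputable def tailProd {ℓ : ℕ} (j : Fin ℓ) (u : S ℓ) : S ℓ :=
  (u - x j) * ∏ t ∈ Finset.Ioi j, (u ^ 2 - x t ^ 2)

theorem sigma2_zero {ℓ : ℕ} (j : Fin ℓ) : sigma2 j 0 = 1 := by
  simp [sigma2, Multiset.esymm]

theorem sigma2_one {ℓ : ℕ} (j : Fin ℓ) : sigma2 j 1 = x j := by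
  simp [sigma2, Multiset.esymm, Multiset.powersetCard_one]

theorem card_Ioi_fin {ℓ : ℕ} (j : Fin ℓ) : (Finset.Ioi j).card = ℓ - (j + 1) := by
  rw [Fin.card_Ioi]
  omega

/-- Vieta's formula; the exponent of `u` is `r - 1`, so the sums over k₂ and k₃ assemble the
right-hand sides for B^C into T_j. -/
theorem sum_sigma2_mul_tau3 {ℓ : ℕ} (j : Fin ℓ) (u : S ℓ) :
    ∑ k₂ ∈ Finset.range 2, ∑ k₃ ∈ Finset.range (ℓ - (j + 1) + 1),
      (-1) ^ (k₂ + k₃) * sigma2 j k₂ * tau3 j k₃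
        * u ^ (2 * ℓ + 2 - 2 * (j + 1) - k₂ - 2 * k₃ - 1) = tailProd j u := by
  have hV := congrArg (Polynomial.eval (u ^ 2))
    (Multiset.prod_X_sub_X_eq_sum_esymm ((Finset.Ioi j).val.map fun t => x t ^ 2))
  rw [Polynomial.eval_multiset_prod, Multiset.map_map, Multiset.map_map, Multiset.card_map,
    ← Finset.card_def, card_Ioi_fin, Polynomial.eval_finsetSum] at hV
  have hprod : ∏ t ∈ Finset.Ioi j, (u ^ 2 - x t ^ 2)
      = ∑ k ∈ Finset.range (ℓ - (j + 1) + 1), (-1) ^ k * tau3 j k * u ^ (2 * (ℓ - (j + 1) - k)) := by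
    rw [Finset.prod_eq_multiset_prod]
    simpa [Function.comp_def, tau3, pow_mul, mul_assoc] using hV
  have hj := j.2
  rw [tailProd, hprod, Finset.sum_range_succ, Finset.sum_range_one, sigma2_zero, sigma2_one,
    sub_mul, sub_eq_add_neg, Finset.mul_sum, Finset.mul_sum, ← Finset.sum_neg_distrib]
  congr 1
  · refine Finset.sum_congr rfl fun k hk => ?_
    have := Finset.mem_range.1 hk
    rw [show 2 * ℓ + 2 - 2 * ((j : ℕ) + 1) - 0 - 2 * k - 1 = 2 * (ℓ - (j + 1) - k) + 1 by omega]
    ring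
  · refine Finset.sum_congr rfl fun k hk => ?_
    have := Finset.mem_range.1 hk
    rw [show 2 * ℓ + 2 - 2 * ((j : ℕ) + 1) - 1 - 2 * k - 1 = 2 * (ℓ - (j + 1) - k) by omega]
    ring

/-- The polynomial in a new variable whose value at `x_i` is `phiCoeff j i`. -/
noncomputable def phiPoly {ℓ : ℕ} (j : Fin ℓ) : Polynomial (S ℓ) :=
  ∑ N₁ ∈ (Finset.Iio j).powerset, ∑ N₂ ∈ (Finset.Iio j).powerset with Disjoint N₁ N₂,
    Polynomial.C ((∏ t ∈ N₁, x t ^ 2) * (∏ t ∈ N₂, -(x t * z ℓ))) *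
      ∑ k₂ ∈ Finset.range 2, ∑ k₃ ∈ Finset.range (ℓ - (j + 1) + 1),
        Polynomial.C ((-1) ^ (k₂ + k₃) * sigma2 j k₂ * tau3 j k₃) *
          aeval ![Polynomial.X, Polynomial.C (z ℓ)]
            (BCbar (2 * ℓ + 2 - 2 * (j + 1) - k₂ - 2 * k₃) (Finset.Iio j \ (N₁ ∪ N₂)).card)

theorem eval_phiPoly {ℓ : ℕ} (j : Fin ℓ) (a : S ℓ) :
    (phiPoly j).eval a =
      ∑ N₁ ∈ (Finset.Iio j).powerset, ∑ N₂ ∈ (Finset.Iio j).powerset with Disjoint N₁ N₂,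
        (∏ t ∈ N₁, x t ^ 2) * (∏ t ∈ N₂, -(x t * z ℓ)) *
          ∑ k₂ ∈ Finset.range 2, ∑ k₃ ∈ Finset.range (ℓ - (j + 1) + 1),
            (-1) ^ (k₂ + k₃) * sigma2 j k₂ * tau3 j k₃ * aeval ![a, z ℓ]
              (BCbar (2 * ℓ + 2 - 2 * (j + 1) - k₂ - 2 * k₃)
                (Finset.Iio j \ (N₁ ∪ N₂)).card) := by
  have h : ∀ p : MvPolynomial (Fin 2) ℝ,
      (aeval ![Polynomial.X, Polynomial.C (z ℓ)] p : Polynomial (S ℓ)).eval a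
        = aeval ![a, z ℓ] p := by
    intro p
    have := map_aeval_pair ((Polynomial.aeval a : Polynomial (S ℓ) →ₐ[S ℓ] S ℓ).restrictScalars ℝ)
      Polynomial.X (Polynomial.C (z ℓ)) p
    simpa [Polynomial.aeval_def] using this
  simp only [phiPoly, Polynomial.eval_finsetSum, Polynomial.eval_mul, Polynomial.eval_C, h]

theorem eval_phiPoly_x {ℓ : ℕ} (j i : Fin ℓ) : (phiPoly j).eval (x i) = phiCoeff j i :=
  eval_phiPoly j (x i)

/-- The natural subtraction does not truncate: the least value, 1, occurs at k₂ = 1 and k₃ = ℓ - (j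
+ 1). -/
theorem r_pos {ℓ : ℕ} (j : Fin ℓ) {k₂ k₃ : ℕ} (h₂ : k₂ ∈ Finset.range 2)
    (h₃ : k₃ ∈ Finset.range (ℓ - (j + 1) + 1)) :
    0 < 2 * ℓ + 2 - 2 * ((j : ℕ) + 1) - k₂ - 2 * k₃ := by
  have := j.2
  rw [Finset.mem_range] at h₂ h₃
  omega

theorem eval_phiPoly_neg {ℓ : ℕ} (j : Fin ℓ) (a : S ℓ) :
    (phiPoly j).eval (-a) = -(phiPoly j).eval a := by
  rw [eval_phiPoly, eval_phiPoly]
  rw [← Finset.sum_neg_distrib]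
  refine Finset.sum_congr rfl fun N₁ _ => ?_
  rw [← Finset.sum_neg_distrib]
  refine Finset.sum_congr rfl fun N₂ _ => ?_
  rw [← mul_neg]
  refine congrArg _ ?_
  rw [← Finset.sum_neg_distrib]
  refine Finset.sum_congr rfl fun k₂ h₂ => ?_
  rw [← Finset.sum_neg_distrib]
  refine Finset.sum_congr rfl fun k₃ h₃ => ?_
  have h' := aeval_BCbar_neg (r_pos j h₂ h₃) (Finset.Iio j \ (N₁ ∪ N₂)).card a (z ℓ)
  rw [h', mul_neg]

/-- The difference equation satisfied by `phiPoly j`. -/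
theorem eval_phiPoly_add_sub {ℓ : ℕ} (j : Fin ℓ) (a : S ℓ) :
    (phiPoly j).eval (a + z ℓ) - (phiPoly j).eval a
      = z ℓ * (∏ t ∈ Finset.Iio j, (x t + a) * (x t - a - z ℓ))
        * (tailProd j (a + z ℓ) + tailProd j (-a)) := by
  have hJ : ∏ t ∈ Finset.Iio j, (x t + a) * (x t - a - z ℓ)
      = ∑ N₁ ∈ (Finset.Iio j).powerset, ∑ N₂ ∈ (Finset.Iio j).powerset with Disjoint N₁ N₂,
        (∏ t ∈ N₁, x t ^ 2) * (∏ t ∈ N₂, -(x t * z ℓ))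
          * ((a + z ℓ) * -a) ^ (Finset.Iio j \ (N₁ ∪ N₂)).card := by
    rw [sum_disjoint_powerset_prod (Finset.Iio j) (fun t => x t ^ 2) (fun t => -(x t * z ℓ))]
    exact Finset.prod_congr rfl fun t _ => by ring
  rw [eval_phiPoly, eval_phiPoly, hJ, mul_assoc, Finset.sum_mul,
    Finset.mul_sum, ← Finset.sum_sub_distrib]
  refine Finset.sum_congr rfl fun N₁ _ => ?_
  rw [Finset.sum_mul, Finset.mul_sum, ← Finset.sum_sub_distrib]
  refine Finset.sum_congr rfl fun N₂ _ => ?_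
  have hT : tailProd j (a + z ℓ) + tailProd j (-a)
      = ∑ k₂ ∈ Finset.range 2, ∑ k₃ ∈ Finset.range (ℓ - (j + 1) + 1),
        (-1) ^ (k₂ + k₃) * sigma2 j k₂ * tau3 j k₃ *
          ((a + z ℓ) ^ (2 * ℓ + 2 - 2 * ((j : ℕ) + 1) - k₂ - 2 * k₃ - 1)
            + (-a) ^ (2 * ℓ + 2 - 2 * ((j : ℕ) + 1) - k₂ - 2 * k₃ - 1)) := by
    simp only [mul_add, Finset.sum_add_distrib, ← sum_sigma2_mul_tau3]
  rw [← mul_sub, ← Finset.sum_sub_distrib, hT, mul_left_comm (z ℓ),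
    mul_assoc _ (_ ^ (Finset.Iio j \ (N₁ ∪ N₂)).card)]
  refine congrArg _ ?_
  rw [Finset.mul_sum, Finset.mul_sum]
  refine Finset.sum_congr rfl fun k₂ h₂ => ?_
  rw [← Finset.sum_sub_distrib, Finset.mul_sum, Finset.mul_sum]
  refine Finset.sum_congr rfl fun k₃ h₃ => ?_
  have h := aeval_BCbar_add_sub (r_pos j h₂ h₃) (Finset.Iio j \ (N₁ ∪ N₂)).card a (z ℓ)
  rw [← mul_sub, h, mul_left_comm _ (z ℓ), mul_comm (_ + _) (_ ^ _), mul_left_comm _ (_ ^ _),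
    mul_left_comm (z ℓ)]

/-! ### The derivations are logarithmic -/

theorem phiC_x {ℓ : ℕ} (j i : Fin ℓ) :
    phiC j (x i) = (-1) ^ ((j : ℕ) + 1) * (phiPoly j).eval (x i) := by
  rw [eval_phiPoly_x, phiC, Derivation.smul_apply, derivation_sum_apply, smul_eq_mul]
  congr 1
  rw [Finset.sum_eq_single i]
  · simp [x]
  · intro k _ hk
    simp [x, pderiv_X, hk.symm]
  · simp

theorem phiC_z {ℓ : ℕ} (j : Fin ℓ) : phiC j (z ℓ) = 0 := by
  rw [phiC, Derivation.smul_apply, derivation_sum_apply]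
  simp [z, pderiv_X]

theorem sub_dvd_tailProd {ℓ : ℕ} {j p : Fin ℓ} (h : j ≤ p) (u : S ℓ) :
    u - x p ∣ tailProd j u := by
  rcases h.eq_or_lt with rfl | h
  · exact dvd_mul_right _ _
  · refine Dvd.dvd.mul_left ?_ _
    exact (Dvd.intro_left (u + x p) (by ring)).trans
      (Finset.dvd_prod_of_mem (fun t => u ^ 2 - x t ^ 2) (Finset.mem_Ioi.2 h))

theorem tailProd_x {ℓ : ℕ} {j p : Fin ℓ} (h : j ≤ p) : tailProd j (x p) = 0 := by
  simpa using sub_dvd_tailProd h (x p)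

theorem tailProd_neg_x {ℓ : ℕ} {j p : Fin ℓ} (h : j < p) : tailProd j (-x p) = 0 := by
  rw [tailProd, Finset.prod_eq_zero (Finset.mem_Ioi.2 h) (by ring), mul_zero]

/-- Used with `a = x q` and `a = -x q`. After replacing x_p by a + z, the divisor appears in the
difference equation as a factor of the product over t < j if p < j, and otherwise in T_j(a + z),
once the other summand T_j(-a) vanishes. -/
theorem dvd_phiPoly_eval_sub {ℓ : ℕ} (j p : Fin ℓ) (a : S ℓ)
    (h : j ≤ p → tailProd j (-a) = 0) :
    x p - a - z ℓ ∣ (phiPoly j).eval (x p) - (phiPoly j).eval a := by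
  have h1 : x p - a - z ℓ ∣ (phiPoly j).eval (x p) - (phiPoly j).eval (a + z ℓ) := by
    rw [sub_sub]
    exact Polynomial.sub_dvd_eval_sub _ _ _
  have h2 : x p - a - z ℓ ∣ (phiPoly j).eval (a + z ℓ) - (phiPoly j).eval a := by
    rw [eval_phiPoly_add_sub]
    rcases lt_or_ge p j with hp | hp
    · refine Dvd.dvd.mul_right (Dvd.dvd.mul_left ?_ _) _
      exact (dvd_mul_left _ _).trans
        (Finset.dvd_prod_of_mem (fun t => (x t + a) * (x t - a - z ℓ)) (Finset.mem_Iio.2 hp))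
    · rw [h hp, add_zero]
      refine Dvd.dvd.mul_left (dvd_trans ?_ (sub_dvd_tailProd hp _)) _
      rw [← dvd_neg]
      exact dvd_of_eq (by ring)
  simpa using dvd_add h1 h2

theorem dvd_phiPoly_add {ℓ : ℕ} (j p q : Fin ℓ) :
    x p + x q ∣ (phiPoly j).eval (x p) + (phiPoly j).eval (x q) := by
  have h := Polynomial.sub_dvd_eval_sub (x p) (-x q) (phiPoly j)
  rwa [eval_phiPoly_neg, sub_neg_eq_add, sub_neg_eq_add] at h

theorem dvd_phiPoly_add_shift {ℓ : ℕ} (j : Fin ℓ) {p q : Fin ℓ} (hpq : p ≤ q) :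
    x p + x q - z ℓ ∣ (phiPoly j).eval (x p) + (phiPoly j).eval (x q) := by
  have h := dvd_phiPoly_eval_sub j p (-x q) fun hj => by
    rw [neg_neg, tailProd_x (hj.trans hpq)]
  rwa [eval_phiPoly_neg, sub_neg_eq_add, sub_neg_eq_add] at h

/-- The strict order matters: T_j(-x_q) vanishes for j < q, but T_j contains only u - x_j and not u
+ x_j. -/
theorem dvd_phiPoly_sub_shift {ℓ : ℕ} (j : Fin ℓ) {p q : Fin ℓ} (hpq : p < q) :
    x p - x q - z ℓ ∣ (phiPoly j).eval (x p) - (phiPoly j).eval (x q) :=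
  dvd_phiPoly_eval_sub j p (x q) fun hj => tailProd_neg_x (hj.trans_lt hpq)

theorem phiC_mem {ℓ : ℕ} (j : Fin ℓ) : phiC j ∈ DSC ℓ := by
  refine ⟨by simp [phiC_z], ?_⟩
  have key : ∀ p q : Fin ℓ, p ≤ q → (x p + x q) ∣ phiC j (x p + x q) ∧
      (x p + x q - z ℓ) ∣ phiC j (x p + x q - z ℓ) := by
    intro p q hpq
    rw [map_sub, phiC_z, sub_zero, map_add, phiC_x, phiC_x, ← mul_add]
    exact ⟨(dvd_phiPoly_add j p q).mul_left _, (dvd_phiPoly_add_shift j hpq).mul_left _⟩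
  rintro α (⟨i, rfl⟩ | ⟨p, q, hpq, rfl | rfl⟩)
  · rw [two_mul]
    exact key i i le_rfl
  · exact key p q hpq.le
  · rw [map_sub _ _ (z ℓ), phiC_z, sub_zero, map_sub, phiC_x, phiC_x, ← mul_sub]
    exact ⟨(Polynomial.sub_dvd_eval_sub _ _ _).mul_left _,
      (dvd_phiPoly_sub_shift j hpq).mul_left _⟩

theorem eulerDer_X {ℓ : ℕ} (v : Option (Fin ℓ)) : eulerDer ℓ (X v) = X v := by
  rw [eulerDer, Derivation.add_apply, derivation_sum_apply]
  rcases v with _ | i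
  · simp [pderiv_X, z]
  · rw [Finset.sum_eq_single i]
    · simp [pderiv_X, x]
    · intro k _ hk
      simp [pderiv_X, hk.symm]
    · simp

theorem eulerDer_mem (ℓ : ℕ) : eulerDer ℓ ∈ DSC ℓ := by
  have hx : ∀ i : Fin ℓ, eulerDer ℓ (x i) = x i := fun i => eulerDer_X _
  have hz : eulerDer ℓ (z ℓ) = z ℓ := eulerDer_X _
  refine ⟨by rw [hz], ?_⟩
  rintro α (⟨i, rfl⟩ | ⟨p, q, -, rfl | rfl⟩)
  · simp [two_mul, hx, hz]
  · simp [hx, hz]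
  · simp [hx, hz]

/-! ### Degree bounds -/

theorem totalDegree_BCbar_le (r s : ℕ) : (BCbar r s).totalDegree ≤ r + 2 * s :=
  (Polynomial.isHomogeneous_homogenize _).totalDegree_le

theorem totalDegree_aeval_pair_le {ℓ : ℕ} (i : Fin ℓ) (p : MvPolynomial (Fin 2) ℝ) :
    (aeval ![x i, z ℓ] p).totalDegree ≤ p.totalDegree := by
  have h : aeval ![x i, z ℓ] p = rename ![some i, none] p := by
    rw [rename_eq_aeval]
    congr 2
    ext k : 1
    fin_cases k <;> rfl
  rw [h]
  exact totalDegree_rename_le _ _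

theorem totalDegree_prod_le_card_mul {α σ R : Type*} [CommSemiring R] (N : Finset α)
    (f : α → MvPolynomial σ R) (n : ℕ) (hf : ∀ t ∈ N, (f t).totalDegree ≤ n) :
    (∏ t ∈ N, f t).totalDegree ≤ N.card * n :=
  (totalDegree_finsetProd _ _).trans (Finset.sum_le_card_nsmul _ _ _ hf)

theorem totalDegree_sigma2_le {ℓ : ℕ} (j : Fin ℓ) {k : ℕ} (hk : k ∈ Finset.range 2) :
    (sigma2 j k).totalDegree ≤ k := by
  rw [Finset.mem_range] at hk
  interval_cases k
  · simp [sigma2_zero]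
  · simp [sigma2_one, x]

theorem totalDegree_tau3_le {ℓ : ℕ} (j : Fin ℓ) (k : ℕ) : (tau3 j k).totalDegree ≤ k * 2 := by
  rw [tau3, Finset.esymm_map_val]
  refine totalDegree_finsetSum_le fun N hN => ?_
  rw [← (Finset.mem_powersetCard.1 hN).2]
  refine totalDegree_prod_le_card_mul _ _ _ fun t _ => ?_
  simp [x, totalDegree_X_pow]

theorem totalDegree_phiCoeff_le {ℓ : ℕ} (j i : Fin ℓ) : (phiCoeff j i).totalDegree ≤ 2 * ℓ := by
  unfold phiCoeff
  refine totalDegree_finsetSum_le fun N₁ h₁ => totalDegree_finsetSum_le fun N₂ h₂ => ?_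
  rw [Finset.mem_filter, Finset.mem_powerset] at h₂
  rw [Finset.mem_powerset] at h₁
  -- With s the cardinality of the complement, the degrees 2|N₁| + 2|N₂| + 2s add to 2j; since r +
  -- k₂ + 2k₃ = 2ℓ - 2j for the zero-based `j`, the total is 2ℓ.
  have hcard : (Finset.Iio j \ (N₁ ∪ N₂)).card + (N₁.card + N₂.card) = j := by
    rw [← Finset.card_union_of_disjoint h₂.2,
      Finset.card_sdiff_add_card_eq_card (Finset.union_subset h₁ h₂.1), Fin.card_Iio]
  have e₁ : (∏ t ∈ N₁, (x t : S ℓ) ^ 2).totalDegree ≤ N₁.card * 2 :=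
    totalDegree_prod_le_card_mul _ _ _ fun t _ => by simp [x, totalDegree_X_pow]
  have e₂ : (∏ t ∈ N₂, -((x t : S ℓ) * z ℓ)).totalDegree ≤ N₂.card * 2 :=
    totalDegree_prod_le_card_mul _ _ _ fun t _ => by
      rw [totalDegree_neg]
      exact (totalDegree_mul _ _).trans (by simp [x, z])
  have e₃ : ∀ k₂ ∈ Finset.range 2, ∀ k₃ ∈ Finset.range (ℓ - (j + 1) + 1),
      ((-1) ^ (k₂ + k₃) * sigma2 j k₂ * tau3 j k₃ * aeval ![x i, z ℓ]
        (BCbar (2 * ℓ + 2 - 2 * (j + 1) - k₂ - 2 * k₃)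
          (Finset.Iio j \ (N₁ ∪ N₂)).card)).totalDegree
        ≤ 2 * ℓ - 2 * j + 2 * (Finset.Iio j \ (N₁ ∪ N₂)).card := by
    intro k₂ h₂ k₃ h₃
    have d₁ := totalDegree_sigma2_le j h₂
    have d₂ := totalDegree_tau3_le j k₃
    have d₃ := (totalDegree_aeval_pair_le i _).trans
      (totalDegree_BCbar_le (2 * ℓ + 2 - 2 * (j + 1) - k₂ - 2 * k₃)
        (Finset.Iio j \ (N₁ ∪ N₂)).card)
    have d₀ : ((-1 : S ℓ) ^ (k₂ + k₃)).totalDegree = 0 := by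
      rcases neg_one_pow_eq_or (S ℓ) (k₂ + k₃) with h | h <;> simp [h]
    have m₁ := totalDegree_mul ((-1 : S ℓ) ^ (k₂ + k₃)) (sigma2 j k₂)
    have m₂ := totalDegree_mul ((-1 : S ℓ) ^ (k₂ + k₃) * sigma2 j k₂) (tau3 j k₃)
    refine (totalDegree_mul _ _).trans ?_
    have := j.2
    rw [Finset.mem_range] at h₂ h₃
    omega
  have e₄ := totalDegree_finsetSum_le fun k₂ h₂ => totalDegree_finsetSum_le (e₃ k₂ h₂)
  refine (totalDegree_mul _ _).trans ((add_le_add (totalDegree_mul _ _) e₄).trans ?_)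
  have := j.2
  omega

open Matrix

theorem natDegree_aeval_pair_le {A : Type*} [CommRing A] [Algebra ℝ A]
    (p : MvPolynomial (Fin 2) ℝ) (b : A) :
    (aeval ![Polynomial.X, Polynomial.C b] p : Polynomial A).natDegree ≤ p.totalDegree := by
  rw [← aeval_map_algebraMap A]
  refine (MvPolynomial.aeval_natDegree_le (m := p.totalDegree) (n := 1) _
    (Finset.sup_mono (support_map_subset _ _)) _ fun i => ?_).trans_eq (mul_one _)
  fin_cases i
  · exact Polynomial.natDegree_X_le
  · simp

theorem natDegree_phiPoly_le {ℓ : ℕ} (j : Fin ℓ) : (phiPoly j).natDegree ≤ 2 * ℓ := by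
  unfold phiPoly
  refine Polynomial.natDegree_sum_le_of_forall_le _ _ fun N₁ _ =>
    Polynomial.natDegree_sum_le_of_forall_le _ _ fun N₂ _ =>
    (Polynomial.natDegree_C_mul_le _ _).trans <|
    Polynomial.natDegree_sum_le_of_forall_le _ _ fun k₂ h₂ =>
    Polynomial.natDegree_sum_le_of_forall_le _ _ fun k₃ h₃ =>
    (Polynomial.natDegree_C_mul_le _ _).trans <|
    (natDegree_aeval_pair_le _ _).trans <| (totalDegree_BCbar_le _ _).trans ?_
  have hcard : (Finset.Iio j \ (N₁ ∪ N₂)).card ≤ j :=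
    (Finset.card_le_card Finset.sdiff_subset).trans_eq (Fin.card_Iio j)
  have := j.2
  rw [Finset.mem_range] at h₂ h₃
  omega

/-! ### Nonvanishing of the determinant at one point -/

/-- A point in the complement of the cone over the Shi arrangement. -/
def complementPoint (ℓ : ℕ) : Option (Fin ℓ) → ℝ := fun v => v.elim 1 fun i => (i : ℝ) + 1

/-- Evaluation at `complementPoint`. -/
noncomputable def evalPoint (ℓ : ℕ) : S ℓ →+* ℝ := eval (complementPoint ℓ)

theorem evalPoint_x {ℓ : ℕ} (i : Fin ℓ) : evalPoint ℓ (x i) = (i : ℝ) + 1 := by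
  simp [evalPoint, x, complementPoint]

theorem evalPoint_z (ℓ : ℕ) : evalPoint ℓ (z ℓ) = 1 := by
  simp [evalPoint, z, complementPoint]

theorem evalPoint_tailProd_ne_zero {ℓ : ℕ} (j : Fin ℓ) :
    evalPoint ℓ (tailProd j (-x j + z ℓ)) ≠ 0 := by
  simp only [tailProd, map_mul, map_sub, map_add, map_neg, map_pow, map_prod, evalPoint_x,
    evalPoint_z]
  have hj : (0 : ℝ) ≤ (j : ℕ) := Nat.cast_nonneg _
  refine mul_ne_zero (by linarith) (Finset.prod_ne_zero_iff.2 fun t ht => ?_)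
  have hlt : ((j : ℕ) : ℝ) < (t : ℕ) := by exact_mod_cast Finset.mem_Ioi.1 ht
  nlinarith

/-- An odd combination of the `phiPoly j` vanishing at all the `x_i` vanishes identically, because
of its degree. -/
theorem sum_evalPoint_phiPoly_eq_zero {ℓ : ℕ} (c : Fin ℓ → ℝ)
    (h : ∀ i, ∑ j, c j * evalPoint ℓ ((phiPoly j).eval (x i)) = 0) (a : S ℓ) :
    ∑ j, c j * evalPoint ℓ ((phiPoly j).eval a) = 0 := by
  set R : Polynomial ℝ := ∑ j, Polynomial.C (c j) * (phiPoly j).map (evalPoint ℓ) with hR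
  have hRe : ∀ a : S ℓ, R.eval (evalPoint ℓ a) = ∑ j, c j * evalPoint ℓ ((phiPoly j).eval a) := by
    intro a
    simp only [hR, Polynomial.eval_finsetSum, Polynomial.eval_mul, Polynomial.eval_C,
      Polynomial.eval_map, Polynomial.eval₂_at_apply]
  have hodd : ∀ a : S ℓ, R.eval (evalPoint ℓ (-a)) = -R.eval (evalPoint ℓ a) := by
    intro a
    rw [hRe, hRe]
    simp only [eval_phiPoly_neg, map_neg, mul_neg, Finset.sum_neg_distrib]
  have hdeg : R.natDegree ≤ 2 * ℓ :=
    Polynomial.natDegree_sum_le_of_forall_le _ _ fun j _ =>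
      (Polynomial.natDegree_C_mul_le _ _).trans
        (Polynomial.natDegree_map_le.trans (natDegree_phiPoly_le j))
  have hx : ∀ i : Fin ℓ, R.eval ((i : ℝ) + 1) = 0 := by
    intro i
    rw [← evalPoint_x, hRe, h]
  -- The roots 1, …, ℓ are the values of the x_i; oddness adds 0 and the negatives, giving 2ℓ + 1
  -- roots.
  have hR0 : R = 0 := by
    refine Polynomial.eq_zero_of_natDegree_lt_card_of_eval_eq_zero' R
      ((Finset.Icc (-(ℓ : ℤ)) ℓ).image ((↑) : ℤ → ℝ)) ?_ ?_
    · intro y hy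
      obtain ⟨n, hn, rfl⟩ := Finset.mem_image.1 hy
      rw [Finset.mem_Icc] at hn
      rcases lt_trichotomy n 0 with h0 | rfl | h0
      · have hi := hx ⟨(-n - 1).toNat, by omega⟩
        have hc : (((-n - 1).toNat : ℕ) : ℝ) + 1 = -n := by
          have : (((-n - 1).toNat : ℕ) : ℤ) + 1 = -n := by omega
          exact_mod_cast this
        have ho := hodd (x ⟨(-n - 1).toNat, by omega⟩)
        simp only [map_neg, evalPoint_x, hc, neg_neg] at ho hi
        rw [ho, hi, neg_zero]
      · have ho := hodd 0
        simp only [neg_zero, map_zero] at ho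
        rw [Int.cast_zero]
        linarith
      · have hi := hx ⟨(n - 1).toNat, by omega⟩
        have hc : (((n - 1).toNat : ℕ) : ℝ) + 1 = n := by
          have : (((n - 1).toNat : ℕ) : ℤ) + 1 = n := by omega
          exact_mod_cast this
        simpa only [hc] using hi
    · rw [Finset.card_image_of_injective _ Int.cast_injective, Int.card_Icc]
      omega
  rw [← hRe, hR0, Polynomial.eval_zero]

/-- Differences at a = -x_j are triangular: for k > j the product over t < k contains x_j + a = 0,
and for k < j the coefficient is zero by induction. -/
theorem eq_zero_of_sum_evalPoint_phiPoly {ℓ : ℕ} (c : Fin ℓ → ℝ)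
    (h : ∀ i, ∑ j, c j * evalPoint ℓ ((phiPoly j).eval (x i)) = 0) (j : Fin ℓ) : c j = 0 := by
  have hz := sum_evalPoint_phiPoly_eq_zero c h
  induction j using WellFoundedLT.induction with
  | _ j ih =>
  have hdiff : ∑ k, c k * evalPoint ℓ ((phiPoly k).eval (-x j + z ℓ) - (phiPoly k).eval (-x j))
      = 0 := by
    simp only [map_sub, mul_sub, Finset.sum_sub_distrib, hz, sub_zero]
  rw [Finset.sum_eq_single j] at hdiff
  · refine (mul_eq_zero.1 hdiff).resolve_right ?_
    rw [eval_phiPoly_add_sub, neg_neg, tailProd_x le_rfl, add_zero, map_mul, map_mul, evalPoint_z,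
      one_mul]
    refine mul_ne_zero ?_ (evalPoint_tailProd_ne_zero j)
    simp only [map_prod, map_mul, map_sub, map_add, map_neg, evalPoint_x, evalPoint_z]
    refine Finset.prod_ne_zero_iff.2 fun t ht => ?_
    have hlt : ((t : ℕ) : ℝ) < (j : ℕ) := by exact_mod_cast Finset.mem_Iio.1 ht
    have ht : (0 : ℝ) ≤ (t : ℕ) := Nat.cast_nonneg _
    exact mul_ne_zero (by linarith) (by linarith)
  · intro k _ hk
    rcases lt_or_gt_of_ne hk with hk | hk
    · rw [ih k hk, zero_mul]
    · rw [eval_phiPoly_add_sub, Finset.prod_eq_zero (Finset.mem_Iio.2 hk) (by ring)]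
      simp
  · simp

theorem det_ne_zero {ℓ : ℕ} (θ : Option (Fin ℓ) → Der ℓ) (h₀ : θ none = eulerDer ℓ)
    (hθ : ∀ j, θ (some j) = phiC j) : (Matrix.of fun i v => θ i (X v)).det ≠ 0 := by
  intro hdet
  have hdet' := congrArg (evalPoint ℓ) hdet
  rw [RingHom.map_det, map_zero, ← exists_vecMul_eq_zero_iff] at hdet'
  obtain ⟨c, hc, hM⟩ := hdet'
  have hcol : ∀ v, c none * evalPoint ℓ (X v)
      + ∑ j, c (some j) * evalPoint ℓ (phiC j (X v)) = 0 := by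
    intro v
    simpa [vecMul, dotProduct, Fintype.sum_option, h₀, hθ, eulerDer_X] using congrFun hM v
  -- Every `phiC j` kills z, so the z-column isolates the Euler derivation.
  have hnone : c none = 0 := by
    have h := hcol none
    rw [← z, evalPoint_z, mul_one] at h
    simpa [phiC_z] using h
  have hsome := eq_zero_of_sum_evalPoint_phiPoly (fun j => c (some j) * (-1) ^ ((j : ℕ) + 1))
    fun i => by
      have h := hcol (some i)
      rw [← x, hnone, zero_mul, zero_add] at h
      rw [← h]
      refine Finset.sum_congr rfl fun j _ => ?_
      rw [phiC_x, map_mul, map_pow, map_neg, map_one, mul_assoc]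
  refine hc (funext fun v => ?_)
  rcases v with _ | j
  · exact hnone
  · exact (mul_eq_zero.1 (hsome j)).resolve_right (pow_ne_zero _ (by norm_num))

end ShiC

theorem theorem4 (ℓ : ℕ) :
    ∃ b : Module.Basis (Option (Fin ℓ)) (ShiC.S ℓ) (ShiC.DSC ℓ),
      (b none : ShiC.Der ℓ) = ShiC.eulerDer ℓ ∧
        ∀ j : Fin ℓ, (b (some j) : ShiC.Der ℓ) = ShiC.phiC j := by
  let θ : Option (Fin ℓ) → ShiC.DSC ℓ := fun v =>
    v.elim ⟨_, ShiC.eulerDer_mem ℓ⟩ fun j => ⟨_, ShiC.phiC_mem j⟩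
  obtain ⟨b, hb⟩ := ShiC.exists_basis_of_det_ne_zero ShiC.shiVec ShiC.shiVec_ne_zero
    ShiC.shiVec_ne_smul (ShiC.DSC ℓ) ShiC.linForm_shiVec_dvd θ
    (fun v => v.elim 1 fun _ => 2 * ℓ) (by
      rintro (_ | j) v
      · simp [θ, ShiC.eulerDer_X]
      · rcases v with _ | i
        · have := ShiC.phiC_z j
          rw [ShiC.z] at this
          simp [θ, this]
        · have h := ShiC.phiC_x j i
          rw [ShiC.eval_phiPoly_x, ShiC.x] at h
          simp only [θ, Option.elim, h]
          rcases neg_one_pow_eq_or (ShiC.S ℓ) ((j : ℕ) + 1) with h | h <;>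
            simpa [h] using ShiC.totalDegree_phiCoeff_le j i)
    -- The degree bounds sum to 1 + ℓ · 2ℓ, the number 2ℓ² + 1 of hyperplanes.
    (by simp [Fintype.sum_option]; nlinarith)
    (ShiC.det_ne_zero (fun v => (θ v : ShiC.Der ℓ)) rfl fun _ => rfl)
  exact ⟨b, congrArg Subtype.val (hb none), fun j => congrArg Subtype.val (hb (some j))⟩
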